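/- **Corollary 3.3 (decidability of bounded-height tree duality).** Digraphs are finite and may have loops and pairs of opposite arcs; write $G\to H$ if there is a homomorphism from $G$ to $H$. A set $\mathcal F$ of digraphs is a *complete set of obstructions* for a digraph $H$ if for every digraph $G$ we have $G\to H$ if and only if there is no $F\in\mathcal F$ with $F\to G$. An *oriented tree* is a digraph obtained by orienting every edge of a finite undirected tree in one direction, and its *algebraic height* is the minimum number of arcs of a directed path to which it admits a homomorphism. A digraph $H$ has *bounded-height tree duality* if there is a constant $m$ such that $H$ has a complete set of obstructions consisting of oriented trees of algebraic height at most $m$. The problem whether an input digraph $H$ (given by its number $n$ of vertices and a list of its arcs, the vertices being $0,\dots,n-1$) has bounded-height tree duality is decidable, i.e. there is an algorithm that halts on every input and answers correctly. -/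

import Mathlib

namespace BoundedHeightTreeDuality

/-- `G → H`: there is a homomorphism from the digraph `G` to the digraph `H`, that is, a map of
vertices that sends every arc of `G` to an arc of `H`. Loops and pairs of opposite arcs are
allowed in digraphs. -/
def HomTo {V W : Type} (G : Digraph V) (H : Digraph W) : Prop :=
  ∃ f : V → W, ∀ u v : V, G.Adj u v → H.Adj (f u) (f v)

/-- A bundled finite digraph; used to speak about sets of finite digraphs. -/
structure FinDigraph where
  /-- The vertex set. -/
  Vert : Type
  /-- There are finitely many vertices. -/
  finite : Finite Vert
  /-- The digraph itself. -/
  graph : Digraph Vert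

/-- An oriented tree: an orientation of an undirected tree. There is no loop and no pair of
opposite arcs, and the underlying undirected graph is a tree (connected, in particular nonempty,
and acyclic). -/
def IsOrientedTree {V : Type} (T : Digraph V) : Prop :=
  (∀ u v : V, T.Adj u v → ¬ T.Adj v u) ∧ T.toSimpleGraphInclusive.IsTree

/-- The directed path with `n` arcs `0 → 1 → ⋯ → n`. -/
def directedPath (n : ℕ) : Digraph (Fin (n + 1)) where
  Adj i j := (i : ℕ) + 1 = (j : ℕ)

/-- The algebraic height: the minimum number of arcs of a directed path to which `T` maps
homomorphically (and `⊤` if there is no such path, which does not happen for finite oriented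
trees). -/
noncomputable def algebraicHeight {V : Type} (T : Digraph V) : ℕ∞ :=
  ⨅ (n : ℕ) (_ : HomTo T (directedPath n)), (n : ℕ∞)

/-- `F` is a complete set of obstructions for `H`: a finite digraph `G` maps to `H` if and only
if no member of `F` maps to `G`. -/
def IsCompleteObstructionSet (F : Set FinDigraph) {W : Type} (H : Digraph W) : Prop :=
  ∀ G : FinDigraph, HomTo G.graph H ↔ ∀ T ∈ F, ¬ HomTo T.graph G.graph

/-- `H` has bounded-height tree duality: for some constant `m`, it has a complete set of
obstructions consisting of oriented trees of algebraic height at most `m`. -/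
def HasBoundedHeightTreeDuality {W : Type} (H : Digraph W) : Prop :=
  ∃ m : ℕ, ∃ F : Set FinDigraph,
    (∀ T ∈ F, IsOrientedTree T.graph ∧ algebraicHeight T.graph ≤ (m : ℕ∞)) ∧
      IsCompleteObstructionSet F H

/-- The input format for digraphs: the number `n` of vertices together with a list of arcs.
The vertices are `0, …, n - 1`. -/
abbrev DigraphCode : Type := ℕ × List (ℕ × ℕ)

/-- The digraph on `{0, …, n - 1}` described by a code `(n, L)`: there is an arc from `u` to `v`
exactly when `(u, v)` occurs in the list `L` (entries of `L` that are not pairs of vertices are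
ignored). Every finite digraph is isomorphic to one of this form. -/
def decode (c : DigraphCode) : Digraph (Fin c.1) where
  Adj u v := ((u : ℕ), (v : ℕ)) ∈ c.2

end BoundedHeightTreeDuality

namespace BoundedHeightTreeDuality

open Relation

/-! Write `P(H)` for the power digraph. An oriented tree maps to `P(H)` only if it maps to `H`, and
conversely `G → P(H)` whenever every tree mapping to `G` maps to `H`. Height at most `m` means
mapping to the directed path `P_m`, so bounded-height tree duality says that for some `m`, `G × P_m
→ P(H)` always implies `G → H` (`hasBoundedHeightTreeDuality_iff_prod`).

The unbounded `m` is then removed (`hasBoundedHeightTreeDuality_iff_walk`). Taking `G = P(H)` gives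
`P(H) → H`; taking `G = H ^ P_m` gives a map `e`, and evaluating it on step functions gives a walk
in `H ^ (H × H)` from one projection to the other, each followed by an endomap of `H`. Conversely, a
walk of length `N` combines two consecutive segments of a walk of length `2N` in `H ^ G` into a
closed walk, whence `G → P(H) → H`.

Both conditions concern finite objects determined by `H`, so exhaustive search over lists decides
them, even primitive recursively. -/

/-! ### Power digraphs, products and height. -/

/-- Arcs between sets of vertices: each vertex of `A` has an out-neighbour in `B` and each vertex
of `B` has an in-neighbour in `A`. -/
def SetArc {W : Type} (H : Digraph W) (A B : Set W) : Prop :=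
  (∀ a ∈ A, ∃ b ∈ B, H.Adj a b) ∧ ∀ b ∈ B, ∃ a ∈ A, H.Adj a b

/-- The digraph of nonempty vertex sets. -/
def powerDigraph {W : Type} (H : Digraph W) : Digraph {A : Set W // A.Nonempty} where
  Adj A B := SetArc H A B

/-- The categorical product of digraphs. -/
def prodDigraph {V X : Type} (G : Digraph V) (K : Digraph X) : Digraph (V × X) where
  Adj p q := G.Adj p.1 q.1 ∧ K.Adj p.2 q.2

theorem HomTo.trans {U V W : Type} {F : Digraph U} {G : Digraph V} {H : Digraph W}
    (h₁ : HomTo F G) (h₂ : HomTo G H) : HomTo F H := by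
  obtain ⟨f, hf⟩ := h₁
  obtain ⟨g, hg⟩ := h₂
  exact ⟨g ∘ f, fun u v h => hg _ _ (hf _ _ h)⟩

theorem HomTo.refl {V : Type} (G : Digraph V) : HomTo G G := ⟨id, fun _ _ h => h⟩

theorem homTo_prodDigraph_iff {U V X : Type} {T : Digraph U} {G : Digraph V} {K : Digraph X} :
    HomTo T (prodDigraph G K) ↔ HomTo T G ∧ HomTo T K := by
  constructor
  · rintro ⟨f, hf⟩
    exact ⟨⟨fun u => (f u).1, fun u v h => (hf u v h).1⟩, ⟨fun u => (f u).2, fun u v h => (hf u v h).2⟩⟩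
  · rintro ⟨⟨f, hf⟩, ⟨g, hg⟩⟩
    exact ⟨fun u => (f u, g u), fun u v h => ⟨hf u v h, hg u v h⟩⟩

theorem homTo_powerDigraph {W : Type} (H : Digraph W) : HomTo H (powerDigraph H) :=
  ⟨fun w => ⟨{w}, Set.singleton_nonempty w⟩, fun u v h => by simpa [powerDigraph, SetArc] using h⟩

theorem directedPath_mono {n m : ℕ} (h : n ≤ m) : HomTo (directedPath n) (directedPath m) :=
  ⟨Fin.castLE (by omega), fun u v huv => by simpa [directedPath] using huv⟩

/-- Shorter paths map to longer ones. This turns the height bound into a factor of a product. -/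
theorem algebraicHeight_le_iff {V : Type} (T : Digraph V) (m : ℕ) :
    algebraicHeight T ≤ m ↔ HomTo T (directedPath m) := by
  constructor
  · intro h
    by_contra hm
    have : ((m + 1 : ℕ) : ℕ∞) ≤ algebraicHeight T := by
      refine le_iInf₂ fun n hn => ?_
      rw [Nat.cast_le]
      by_contra hlt
      exact hm (hn.trans (directedPath_mono (by omega)))
    have := this.trans h
    rw [Nat.cast_le] at this
    omega
  · intro h
    exact iInf₂_le m h

/-! ### Homomorphisms from trees to the power digraph -/

/-- Induction on the number of vertices: delete a leaf, select on the rest, and extend to the leaf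
across its only arc. -/
theorem exists_selection_of_isOrientedTree (n : ℕ) : ∀ {V W : Type} [Finite V] (T : Digraph V)
    (H : Digraph W), Nat.card V = n → IsOrientedTree T → ∀ A : V → Set W, (∀ v, (A v).Nonempty) →
    (∀ u v, T.Adj u v → SetArc H (A u) (A v)) →
    ∃ g : V → W, (∀ v, g v ∈ A v) ∧ ∀ u v, T.Adj u v → H.Adj (g u) (g v) := by
  classical
  induction n with
  | zero =>
    intro V W _ T H hn hT A _ _
    have := hT.2.connected.nonempty
    exact absurd hn Nat.card_pos.ne'
  | succ n ih =>
    intro V W _ T H hn hT A hA hTA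
    have := hT.2.connected.nonempty
    have := Fintype.ofFinite V
    have hirr : ∀ v, ¬ T.Adj v v := fun v h => hT.1 v v h h
    rcases subsingleton_or_nontrivial V with hs | hs
    · choose g hg using hA
      refine ⟨g, hg, fun u v h => ?_⟩
      rw [Subsingleton.elim u v] at h
      exact absurd h (hirr v)
    obtain ⟨v, hv⟩ := hT.2.exists_vert_degree_one_of_nontrivial
    obtain ⟨u, huv, huniq⟩ := SimpleGraph.degree_eq_one_iff_existsUnique_adj.mp hv
    let T' : Digraph ({v}ᶜ : Set V) := ⟨fun x y => T.Adj x y⟩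
    have hT'eq : T'.toSimpleGraphInclusive = T.toSimpleGraphInclusive.induce {v}ᶜ := by
      ext x y
      simp [Digraph.toSimpleGraphInclusive, T', SimpleGraph.fromRel_adj, Subtype.ext_iff]
    have hT' : IsOrientedTree T' := by
      refine ⟨fun x y h => hT.1 x y h, ?_⟩
      rw [hT'eq]
      exact ⟨hT.2.connected.induce_compl_singleton_of_degree_eq_one hv, hT.2.isAcyclic.induce _⟩
    have hcard : Nat.card ({v}ᶜ : Set V) = n := by
      rw [Nat.card_eq_fintype_card] at hn ⊢
      rw [Fintype.card_compl_set, hn]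
      simp
    obtain ⟨g, hgA, hg⟩ := ih T' H hcard hT' (fun x => A x) (fun x => hA x)
      (fun x y h => hTA x y h)
    have hne : u ≠ v := fun h => by simp [h] at huv
    have hnbr : ∀ x, T.Adj v x ∨ T.Adj x v → x = u := fun x hx => by
      refine huniq x ?_
      change T.toSimpleGraphInclusive.Adj v x
      rw [Digraph.toSimpleGraphInclusive, SimpleGraph.fromRel_adj]
      refine ⟨?_, hx⟩
      rintro rfl
      exact hirr v (by simpa using hx)
    -- Only one of the two arcs between `u` and `v` is present; the matching half of `SetArc`
    -- supplies `a`, and the other implication is vacuous.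
    have key : ∃ a ∈ A v, (T.Adj v u → H.Adj a (g ⟨u, hne⟩)) ∧
        (T.Adj u v → H.Adj (g ⟨u, hne⟩) a) := by
      rw [Digraph.toSimpleGraphInclusive, SimpleGraph.fromRel_adj] at huv
      rcases huv.2 with h | h
      · obtain ⟨a, ha, haa⟩ := (hTA v u h).2 _ (hgA ⟨u, hne⟩)
        exact ⟨a, ha, fun _ => haa, fun h' => absurd h' (hT.1 _ _ h)⟩
      · obtain ⟨a, ha, haa⟩ := (hTA u v h).1 _ (hgA ⟨u, hne⟩)
        exact ⟨a, ha, fun h' => absurd h' (hT.1 _ _ h), fun _ => haa⟩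
    obtain ⟨a, ha, ha1, ha2⟩ := key
    refine ⟨fun x => if h : x = v then a else g ⟨x, h⟩, fun x => ?_, fun x y hxy => ?_⟩
    · by_cases h : x = v
      · subst h; simpa using ha
      · simpa [h] using hgA ⟨x, h⟩
    · by_cases hx : x = v <;> by_cases hy : y = v
      · subst hx; subst hy; exact absurd hxy (hirr _)
      · subst hx
        obtain rfl := hnbr y (Or.inl hxy)
        simpa [hy] using ha1 hxy
      · subst hy
        obtain rfl := hnbr x (Or.inr hxy)
        simpa [hx] using ha2 hxy
      · simpa [hx, hy] using hg ⟨x, hx⟩ ⟨y, hy⟩ hxy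

theorem IsOrientedTree.homTo_of_homTo_powerDigraph {V W : Type} [Finite V] {T : Digraph V}
    {H : Digraph W} (hT : IsOrientedTree T) (h : HomTo T (powerDigraph H)) : HomTo T H := by
  obtain ⟨A, hA⟩ := h
  obtain ⟨g, -, hg⟩ := exists_selection_of_isOrientedTree _ T H rfl hT (fun v => (A v).1)
    (fun v => (A v).2) hA
  exact ⟨g, hg⟩

/-! ### Rooted oriented trees -/

/-- Syntactic rooted oriented trees: `join d c t` attaches the root of `c` to the root of `t` by
an arc, leaving the root of `t` if and only if `d` is true. -/
inductive RootedTree : Type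
  | leaf : RootedTree
  | join (d : Bool) (c t : RootedTree) : RootedTree

namespace RootedTree

/-- `t.Sat G x`: the tree `t` maps to `G` with its root going to `x`. -/
def Sat {V : Type} (G : Digraph V) : RootedTree → V → Prop
  | leaf, _ => True
  | join d c t, x => t.Sat G x ∧ ∃ y, (if d then G.Adj x y else G.Adj y x) ∧ c.Sat G y

/-- Identifies the roots of two trees. -/
def glue : RootedTree → RootedTree → RootedTree
  | leaf, t => t
  | join d c s, t => join d c (glue s t)

theorem sat_glue {V : Type} (G : Digraph V) (s t : RootedTree) (x : V) :
    (glue s t).Sat G x ↔ s.Sat G x ∧ t.Sat G x := by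
  induction s with
  | leaf => simp [glue, Sat]
  | join d c s _ ihs => simp only [glue, Sat, ihs]; tauto

/-- If each `w` in a finite set fails some tree with root at `x`, one tree fails for all. -/
theorem exists_forall_not_sat {V W : Type} (G : Digraph V) (H : Digraph W) (x : V) (S : Set W)
    (hS : S.Finite) (h : ∀ w ∈ S, ∃ t : RootedTree, t.Sat G x ∧ ¬ t.Sat H w) :
    ∃ t : RootedTree, t.Sat G x ∧ ∀ w ∈ S, ¬ t.Sat H w := by
  induction S, hS using Set.Finite.induction_on with
  | empty => exact ⟨leaf, trivial, by simp⟩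
  | @insert a S _ _ ih =>
    obtain ⟨t, ht, ht'⟩ := ih fun w hw => h w (Set.mem_insert_of_mem _ hw)
    obtain ⟨s, hs, hs'⟩ := h a (Set.mem_insert _ _)
    refine ⟨glue s t, (sat_glue ..).2 ⟨hs, ht⟩, fun w hw hsat => ?_⟩
    rw [sat_glue] at hsat
    rcases hw with rfl | hw
    · exact hs' hsat.1
    · exact ht' w hw hsat.2

end RootedTree

/-- Joins two digraphs by an arc between given vertices. -/
def joinDigraph {U V : Type} (d : Bool) (C : Digraph U) (c : U) (T : Digraph V) (r : V) :
    Digraph (U ⊕ V) where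
  Adj
    | .inl x, .inl y => C.Adj x y
    | .inr x, .inr y => T.Adj x y
    | .inr x, .inl y => d = true ∧ x = r ∧ y = c
    | .inl y, .inr x => d = false ∧ x = r ∧ y = c

/-- The sum with a bridge is connected, and its edge count is again one less than its vertex count.
-/
theorem isTree_sum_sup_edge {U V : Type} [Finite U] [Finite V] {G : SimpleGraph U}
    {K : SimpleGraph V} (hG : G.IsTree) (hK : K.IsTree) (u : U) (v : V) :
    ((G ⊕g K) ⊔ SimpleGraph.edge (.inl u) (.inr v)).IsTree := by
  rw [SimpleGraph.isTree_iff_connected_and_card] at hG hK ⊢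
  refine ⟨hG.1.sum_sup_edge hK.1, ?_⟩
  have hdisj : Disjoint (G ⊕g K).edgeSet {s(.inl u, .inr v)} := by
    rw [Set.disjoint_singleton_right]
    simp
  rw [SimpleGraph.edgeSet_sup, SimpleGraph.edgeSet_edge_of_ne (by simp),
    Nat.card_coe_set_eq, Set.ncard_union_eq hdisj (Set.toFinite _) (Set.toFinite _),
    Set.ncard_singleton, ← Nat.card_coe_set_eq, Nat.card_congr SimpleGraph.edgeSetSumEquiv,
    Nat.card_sum, Nat.card_sum]
  omega

theorem isOrientedTree_joinDigraph {U V : Type} [Finite U] [Finite V] (d : Bool) {C : Digraph U}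
    (c : U) {T : Digraph V} (r : V) (hC : IsOrientedTree C) (hT : IsOrientedTree T) :
    IsOrientedTree (joinDigraph d C c T r) := by
  constructor
  · rintro (x | x) (y | y) h
    · exact hC.1 x y h
    · rintro ⟨h', -⟩
      simp_all [joinDigraph]
    · rintro ⟨h', -⟩
      simp_all [joinDigraph]
    · exact hT.1 x y h
  · convert isTree_sum_sup_edge hC.2 hT.2 c r
    ext x y
    rcases x with x | x <;> rcases y with y | y <;> cases d <;>
      simp [Digraph.toSimpleGraphInclusive, joinDigraph, SimpleGraph.edge_adj] <;> tauto

/-- Links the recursive `Sat`, convenient for gluing and extending trees, with homomorphisms from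
genuine oriented trees. -/
theorem RootedTree.exists_isOrientedTree (t : RootedTree) :
    ∃ (V : Type) (_ : Finite V) (T : Digraph V) (r : V), IsOrientedTree T ∧
      ∀ {X : Type} (G : Digraph X) (x : X), t.Sat G x ↔
        ∃ f : V → X, (∀ u v, T.Adj u v → G.Adj (f u) (f v)) ∧ f r = x := by
  induction t with
  | leaf =>
    refine ⟨Unit, inferInstance, ⟨fun _ _ => False⟩, (), ⟨fun _ _ h => h.elim, .of_subsingleton⟩,
      fun G x => ?_⟩
    simp only [Sat, true_iff]
    exact ⟨fun _ => x, fun _ _ h => h.elim, rfl⟩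
  | join d c t ihc iht =>
    obtain ⟨U, _, C, rc, hC, hsC⟩ := ihc
    obtain ⟨V, _, T, rt, hT, hsT⟩ := iht
    refine ⟨U ⊕ V, inferInstance, joinDigraph d C rc T rt, .inr rt,
      isOrientedTree_joinDigraph d rc rt hC hT, fun G x => ?_⟩
    simp only [Sat, hsC, hsT]
    constructor
    · rintro ⟨⟨f, hf, rfl⟩, _, harc, g, hg, rfl⟩
      refine ⟨Sum.elim g f, ?_, rfl⟩
      rintro (x | x) (y | y) h
      · exact hg _ _ h
      · obtain ⟨rfl, rfl, rfl⟩ := h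
        simpa using harc
      · obtain ⟨rfl, rfl, rfl⟩ := h
        simpa using harc
      · exact hf _ _ h
    · rintro ⟨f, hf, rfl⟩
      refine ⟨⟨fun v => f (.inr v), fun u v h => hf _ _ h, rfl⟩, f (.inl rc), ?_,
        fun u => f (.inl u), fun u v h => hf _ _ h, rfl⟩
      cases d
      · simpa using hf (.inl rc) (.inr rt) ⟨rfl, rfl, rfl⟩
      · simpa using hf (.inr rt) (.inl rc) ⟨rfl, rfl, rfl⟩

/-! ### Arc consistency and the product criterion. -/

/-- Arc consistency: if every oriented tree mapping to `G` maps to `H`, then `G` maps to the power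
digraph of `H`. -/
theorem homTo_powerDigraph_of_forall_tree {V W : Type} [Finite W] (G : Digraph V) (H : Digraph W)
    (h : ∀ T : FinDigraph, IsOrientedTree T.graph → HomTo T.graph G → HomTo T.graph H) :
    HomTo G (powerDigraph H) := by
  have hroot : ∀ (t : RootedTree) (v : V), t.Sat G v → ∃ w, t.Sat H w := fun t v hv => by
    obtain ⟨U, hU, T, r, hT, hsat⟩ := t.exists_isOrientedTree
    obtain ⟨f, hf, -⟩ := (hsat G v).1 hv
    obtain ⟨g, hg⟩ := h ⟨U, hU, T⟩ hT ⟨f, hf⟩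
    exact ⟨g r, (hsat H _).2 ⟨g, hg, rfl⟩⟩
  let A : V → Set W := fun v => {w | ∀ t : RootedTree, t.Sat G v → t.Sat H w}
  -- If every `w` fails some tree holding at `v`, gluing these trees at the root gives one that
  -- holds at `v` but nowhere in `H`.
  have hA : ∀ v, (A v).Nonempty := fun v => by
    by_contra hemp
    rw [Set.not_nonempty_iff_eq_empty, Set.eq_empty_iff_forall_notMem] at hemp
    obtain ⟨t, ht, ht'⟩ := RootedTree.exists_forall_not_sat G H v Set.univ Set.finite_univ
      fun w _ => by simpa [A] using hemp w
    obtain ⟨w, hw⟩ := hroot t v ht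
    exact ht' w trivial hw
  have step : ∀ (d : Bool) (u v : V), (if d then G.Adj u v else G.Adj v u) → ∀ a ∈ A u,
      ∃ b ∈ A v, if d then H.Adj a b else H.Adj b a := fun d u v huv a ha => by
    by_contra! hcon
    obtain ⟨t, ht, ht'⟩ := RootedTree.exists_forall_not_sat G H v
      {b | if d then H.Adj a b else H.Adj b a} (Set.toFinite _) fun b hb => by
        have : b ∉ A v := fun hbA => hcon b hbA hb
        simpa [A] using this
    -- Hanging `t` below a new root gives a tree that holds at `u`, hence at `a`; so some neighbour
    -- of `a` satisfies `t`.
    obtain ⟨-, b, hb, hsat⟩ := ha (.join d t .leaf) ⟨trivial, v, huv, ht⟩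
    exact ht' b hb hsat
  refine ⟨fun v => ⟨A v, hA v⟩, fun u v huv => ⟨fun a ha => ?_, fun b hb => ?_⟩⟩
  · simpa using step true u v (by simpa using huv) a ha
  · simpa using step false v u (by simpa using huv) b hb

/-- Bounded-height tree duality through products with a directed path. -/
theorem hasBoundedHeightTreeDuality_iff_prod {W : Type} [Finite W] (H : Digraph W) :
    HasBoundedHeightTreeDuality H ↔ ∃ m : ℕ, ∀ G : FinDigraph,
      HomTo (prodDigraph G.graph (directedPath m)) (powerDigraph H) → HomTo G.graph H := by
  constructor
  · rintro ⟨m, F, hF, hobs⟩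
    refine ⟨m, fun G hG => ?_⟩
    rw [hobs G]
    intro T hTF hTG
    obtain ⟨hT, hm⟩ := hF T hTF
    have := T.finite
    rw [algebraicHeight_le_iff] at hm
    have hTH := hT.homTo_of_homTo_powerDigraph ((homTo_prodDigraph_iff.2 ⟨hTG, hm⟩).trans hG)
    -- The obstruction `T` maps to itself, so it cannot map to `H`.
    exact (hobs T).1 hTH T hTF (HomTo.refl _)
  · rintro ⟨m, hm⟩
    refine ⟨m, {T | IsOrientedTree T.graph ∧ algebraicHeight T.graph ≤ m ∧ ¬ HomTo T.graph H},
      fun T hT => ⟨hT.1, hT.2.1⟩, fun G => ⟨fun hG T hT hTG => hT.2.2 (hTG.trans hG), fun hG => ?_⟩⟩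
    refine hm G (homTo_powerDigraph_of_forall_tree _ _ fun T hT hTG => ?_)
    rw [homTo_prodDigraph_iff, ← algebraicHeight_le_iff] at hTG
    by_contra hTH
    exact hG T ⟨hT, hTG.2, hTH⟩ hTG.1

/-! ### Walks in the exponential digraph -/

/-- Arcs of the exponential digraph `H ^ (H × H)`. -/
def BinaryArc {W : Type} (H : Digraph W) (φ ψ : W × W → W) : Prop :=
  ∀ a b a' b', H.Adj a a' → H.Adj b b' → H.Adj (φ (a, b)) (ψ (a', b'))

theorem exists_seq_of_transGen {α : Type} {r : α → α → Prop} {a b : α} (h : TransGen r a b) :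
    ∃ (N : ℕ) (s : ℕ → α), 0 < N ∧ s 0 = a ∧ s N = b ∧ ∀ i < N, r (s i) (s (i + 1)) := by
  induction h with
  | @single b h =>
    refine ⟨1, fun i => if i = 0 then a else b, by simp, by simp, by simp, fun i hi => ?_⟩
    obtain rfl : i = 0 := by omega
    simpa using h
  | @tail b c _ h ih =>
    obtain ⟨N, s, hN, h0, hb, hs⟩ := ih
    refine ⟨N + 1, fun i => if i ≤ N then s i else c, by simp, by simpa using h0, by simp,
      fun i hi => ?_⟩
    rcases Nat.lt_or_ge i N with hlt | hge
    · simpa [hlt.le, Nat.succ_le_of_lt hlt] using hs i hlt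
    · obtain rfl : i = N := by omega
      simpa [hb] using h

/-- A closed walk in `H ^ G` yields a homomorphism from `G` to the power digraph of `H`. -/
theorem homTo_powerDigraph_of_closed_walk {V W : Type} (G : Digraph V) (H : Digraph W) (N : ℕ)
    (hN : 0 < N) (χ : ℕ → V → W) (hχ : χ N = χ 0)
    (h : ∀ i < N, ∀ u v, G.Adj u v → H.Adj (χ i u) (χ (i + 1) v)) :
    HomTo G (powerDigraph H) := by
  -- Each `u` goes to the set of its values along the walk. The next step gives out-neighbours and
  -- the previous step in-neighbours; closedness handles the wrap-around.
  refine ⟨fun u => ⟨{a | ∃ j < N, χ j u = a}, χ 0 u, 0, hN, rfl⟩, fun u v huv => ⟨?_, ?_⟩⟩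
  · rintro _ ⟨j, hj, rfl⟩
    refine ⟨χ (j + 1) v, ?_, h j hj u v huv⟩
    rcases Nat.lt_or_ge (j + 1) N with hlt | hge
    · exact ⟨j + 1, hlt, rfl⟩
    · obtain rfl : N = j + 1 := by omega
      exact ⟨0, hN, by rw [hχ]⟩
  · rintro _ ⟨j, hj, rfl⟩
    rcases j with _ | j
    · refine ⟨χ (N - 1) u, ⟨N - 1, by omega, rfl⟩, ?_⟩
      have := h (N - 1) (by omega) u v huv
      rwa [Nat.sub_add_cancel hN, hχ] at this
    · exact ⟨χ j u, ⟨j, by omega, rfl⟩, h j (by omega) u v huv⟩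

/-- A digraph has bounded-height tree duality if and only if it has tree duality and the
exponential digraph `H ^ (H × H)` has a nontrivial directed walk from `e ∘ snd` to `e ∘ fst` for
some `e`. -/
theorem hasBoundedHeightTreeDuality_iff_walk {W : Type} [Finite W] (H : Digraph W) :
    HasBoundedHeightTreeDuality H ↔ HomTo (powerDigraph H) H ∧
      ∃ φ : W × W → W, (∀ a a' b, φ (a, b) = φ (a', b)) ∧
        TransGen (BinaryArc H) φ (φ ∘ Prod.swap) := by
  rw [hasBoundedHeightTreeDuality_iff_prod]
  constructor
  · rintro ⟨m, hm⟩
    constructor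
    · exact hm ⟨_, inferInstance, powerDigraph H⟩ (homTo_prodDigraph_iff.1 (HomTo.refl _)).1
    -- Here `G` is the exponential `H ^ P_m`; evaluation maps its product with `P_m` to `H`.
    · obtain ⟨e, he⟩ := hm ⟨Fin (m + 1) → W, inferInstance,
        ⟨fun f g => ∀ i j, (directedPath m).Adj i j → H.Adj (f i) (g j)⟩⟩
        (HomTo.trans ⟨fun p => p.1 p.2, fun p q h => h.1 _ _ h.2⟩ (homTo_powerDigraph H))
      -- The threshold `k` moves up by one along each arc, as the position in the path does. At `k =
      -- 0` the step function is constantly `p.2`, at `k = m + 1` constantly `p.1`.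
      let φ : ℕ → W × W → W := fun k p => e fun i => if (i : ℕ) < k then p.1 else p.2
      have hφ : ∀ k, BinaryArc H (φ k) (φ (k + 1)) := fun k a b a' b' ha hb => by
        refine he _ _ fun i j hij => ?_
        have hij : (i : ℕ) + 1 = j := hij
        by_cases hik : (i : ℕ) < k
        · simpa [hik, show (j : ℕ) < k + 1 by omega] using ha
        · simpa [hik, show ¬ (j : ℕ) < k + 1 by omega] using hb
      have htrans : ∀ k, TransGen (BinaryArc H) (φ 0) (φ (k + 1)) := fun k => by
        induction k with
        | zero => exact .single (hφ 0)
        | succ k ih => exact ih.tail (hφ (k + 1))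
      refine ⟨φ 0, fun a a' b => by simp [φ], ?_⟩
      convert htrans m
      ext p
      simp [φ, Fin.is_le]
  · rintro ⟨hpow, φ, hφ, hwalk⟩
    obtain ⟨N, s, hN, h0, hNs, hs⟩ := exists_seq_of_transGen hwalk
    refine ⟨2 * N, fun G hG => ?_⟩
    obtain ⟨g, hg⟩ := hG.trans hpow
    -- The `min` only makes `ψ` total; the walk uses indices up to `2 * N`.
    let ψ : ℕ → G.Vert → W := fun i u => g (u, ⟨min i (2 * N), by omega⟩)
    have hψ : ∀ i < 2 * N, ∀ u v, G.graph.Adj u v → H.Adj (ψ i u) (ψ (i + 1) v) :=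
      fun i hi u v huv => hg _ _ ⟨huv, by simp [directedPath]; omega⟩
    -- Since `φ` depends only on its second argument, both ends equal `φ` with second argument `ψ N
    -- u`: at the start `ψ N` stands second, at the end it stands first but is swapped.
    refine HomTo.trans (homTo_powerDigraph_of_closed_walk G.graph H N hN
      (fun i u => s i (ψ i u, ψ (N + i) u)) ?_ fun i hi u v huv => ?_) hpow
    · funext u
      simp only [h0, hNs, Function.comp, Prod.swap, Nat.add_zero]
      exact hφ _ _ _
    · exact hs i hi _ _ _ _ (hψ i (by omega) u v huv) (hψ (N + i) (by omega) u v huv)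

end BoundedHeightTreeDuality

/-! ### Primitive recursive predicates with bounded quantifiers -/

section Primrec

variable {α β : Type*} [Primcodable α] [Primcodable β]

theorem PrimrecPred.exists_mem {f : α → List β} {R : α → β → Prop} (hf : Primrec f)
    (hR : PrimrecPred fun p : α × β => R p.1 p.2) : PrimrecPred fun a => ∃ b ∈ f a, R a b :=
  (PrimrecRel.exists_mem_list (R := fun b a => R a b)
    (hR.comp (Primrec.snd.pair Primrec.fst))).comp hf Primrec.id

theorem PrimrecPred.forall_mem {f : α → List β} {R : α → β → Prop} (hf : Primrec f)
    (hR : PrimrecPred fun p : α × β => R p.1 p.2) : PrimrecPred fun a => ∀ b ∈ f a, R a b :=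
  (PrimrecRel.forall_mem_list (R := fun b a => R a b)
    (hR.comp (Primrec.snd.pair Primrec.fst))).comp hf Primrec.id

theorem PrimrecPred.imp {p q : α → Prop} (hp : PrimrecPred p) (hq : PrimrecPred q) :
    PrimrecPred fun a => p a → q a :=
  (hp.not.or hq).of_eq fun _ => imp_iff_not_or.symm

theorem PrimrecPred.mem {f : α → β} {g : α → List β} (hf : Primrec f) (hg : Primrec g) :
    PrimrecPred fun a => f a ∈ g a :=
  (PrimrecPred.exists_mem (R := fun a b => b = f a) hg
    (Primrec.eq.comp Primrec.snd (hf.comp Primrec.fst))).of_eq fun a => by simp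

theorem Primrec.list_sublists' : Primrec (List.sublists' : List α → List (List α)) := by
  have hmap : Primrec₂ fun (_ : List α) (p : α × List (List α)) => p.2 ++ p.2.map (p.1 :: ·) :=
    Primrec.list_append.comp (snd.comp snd) (Primrec.list_map (snd.comp snd)
      (Primrec.list_cons.comp (fst.comp (snd.comp fst)) snd))
  refine (Primrec.list_foldr Primrec.id (Primrec.const [[]]) hmap).of_eq fun L => ?_
  induction L with
  | nil => simp
  | cons a L ih =>
    rw [List.sublists'_cons, ← ih]
    rfl

end Primrec

namespace BoundedHeightTreeDuality

open Relation

/-! ### Enumeration of functions between lists. -/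

/-- All functions from the list `X` to the list `Y`, as association lists. -/
def assignments {α β : Type} (X : List α) (Y : List β) : List (List (α × β)) :=
  X.foldr (fun x acc => acc.flatMap fun w => Y.map fun y => (x, y) :: w) [[]]

/-- Without `Nodup`, a repeated key could receive two different values. -/
theorem mem_assignments_iff {α β : Type} [Inhabited β] {X : List α} (hX : X.Nodup) {Y : List β}
    {w : List (α × β)} :
    w ∈ assignments X Y ↔ ∃ g : α → β, (∀ x ∈ X, g x ∈ Y) ∧ w = X.map fun x => (x, g x) := by
  classical
  induction X generalizing w with
  | nil => simp [assignments]
  | cons x X ih =>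
    have hx : x ∉ X := (List.nodup_cons.1 hX).1
    have hcons : w ∈ assignments (x :: X) Y ↔
        ∃ w' ∈ assignments X Y, ∃ y ∈ Y, (x, y) :: w' = w := by
      simp [assignments]
    rw [hcons]
    constructor
    · rintro ⟨w', hw', y, hy, rfl⟩
      obtain ⟨g, hg, rfl⟩ := (ih (List.nodup_cons.1 hX).2).1 hw'
      have hne : ∀ z ∈ X, z ≠ x := fun z hz h => hx (h ▸ hz)
      refine ⟨Function.update g x y, fun z hz => ?_, ?_⟩
      · rcases List.mem_cons.1 hz with rfl | hz
        · simpa using hy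
        · simpa [hne z hz] using hg z hz
      · simp only [List.map_cons, Function.update_self, List.cons.injEq, true_and]
        exact List.map_congr_left fun z hz => by simp [hne z hz]
    · rintro ⟨g, hg, rfl⟩
      exact ⟨_, (ih (List.nodup_cons.1 hX).2).2 ⟨g, fun z hz => hg z (by simp [hz]), rfl⟩,
        g x, hg x (by simp), rfl⟩

theorem primrec_assignments {α β : Type} [Primcodable α] [Primcodable β] :
    Primrec₂ (assignments : List α → List β → List (List (α × β))) := by
  have hstep : Primrec₂ fun (P : List α × List β) (p : α × List (List (α × β))) =>
      p.2.flatMap fun w => P.2.map fun y => (p.1, y) :: w := by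
    refine Primrec.list_flatMap (Primrec.snd.comp Primrec.snd) ?_
    refine Primrec.list_map (Primrec.snd.comp (Primrec.fst.comp Primrec.fst)) ?_
    exact Primrec.list_cons.comp
      ((Primrec.fst.comp (Primrec.snd.comp (Primrec.fst.comp Primrec.fst))).pair Primrec.snd)
      (Primrec.snd.comp Primrec.fst)
  exact Primrec.list_foldr Primrec.fst (Primrec.const [[]]) hstep

/-! ### Tree duality of an encoded digraph -/

/-- The nonempty lists of vertices, one for each nonempty set of vertices. -/
def vertexSets (n : ℕ) : List (List ℕ) :=
  (List.range n).sublists'.filter (· ≠ [])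

/-- Arcs of the power digraph, on lists. -/
def ListSetArc (L : List (ℕ × ℕ)) (s t : List ℕ) : Prop :=
  (∀ a ∈ s, ∃ b ∈ t, (a, b) ∈ L) ∧ ∀ b ∈ t, ∃ a ∈ s, (a, b) ∈ L

theorem lt_of_mem_vertexSets {n : ℕ} {s : List ℕ} (hs : s ∈ vertexSets n) {a : ℕ} (ha : a ∈ s) :
    a < n := by
  have : s.Sublist (List.range n) := by
    have := List.mem_filter.1 hs
    simpa using this.1
  simpa using this.subset ha

theorem nonempty_of_mem_vertexSets {n : ℕ} {s : List ℕ} (hs : s ∈ vertexSets n) :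
    {x : Fin n | (x : ℕ) ∈ s}.Nonempty := by
  have hne : s ≠ [] := by simpa using (List.mem_filter.1 hs).2
  obtain ⟨a, ha⟩ := List.exists_mem_of_ne_nil s hne
  exact ⟨⟨a, lt_of_mem_vertexSets hs ha⟩, ha⟩

theorem nodup_vertexSets (n : ℕ) : (vertexSets n).Nodup :=
  (List.nodup_sublists'.2 List.nodup_range).filter _

theorem exists_mem_vertexSets {n : ℕ} (A : Set (Fin n)) (hA : A.Nonempty) :
    ∃ s ∈ vertexSets n, {x : Fin n | (x : ℕ) ∈ s} = A := by
  classical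
  refine ⟨(List.range n).filter fun a => ∃ h : a < n, (⟨a, h⟩ : Fin n) ∈ A, ?_, ?_⟩
  · obtain ⟨a, ha⟩ := hA
    refine List.mem_filter.2 ⟨by simp, ?_⟩
    simp only [ne_eq, decide_eq_true_eq]
    exact List.ne_nil_of_mem (a := (a : ℕ)) (by simp [ha])
  · ext x
    simp

theorem listSetArc_iff {c : DigraphCode} {s t : List ℕ} (hs : s ∈ vertexSets c.1)
    (ht : t ∈ vertexSets c.1) :
    ListSetArc c.2 s t ↔ SetArc (decode c) {x | (x : ℕ) ∈ s} {x | (x : ℕ) ∈ t} := by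
  constructor
  · rintro ⟨h₁, h₂⟩
    refine ⟨fun a ha => ?_, fun b hb => ?_⟩
    · obtain ⟨b, hb, hab⟩ := h₁ a ha
      exact ⟨⟨b, lt_of_mem_vertexSets ht hb⟩, hb, hab⟩
    · obtain ⟨a, ha, hab⟩ := h₂ b hb
      exact ⟨⟨a, lt_of_mem_vertexSets hs ha⟩, ha, hab⟩
  · rintro ⟨h₁, h₂⟩
    refine ⟨fun a ha => ?_, fun b hb => ?_⟩
    · obtain ⟨b, hb, hab⟩ := h₁ ⟨a, lt_of_mem_vertexSets hs ha⟩ ha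
      exact ⟨b, hb, hab⟩
    · obtain ⟨a, ha, hab⟩ := h₂ ⟨b, lt_of_mem_vertexSets ht hb⟩ hb
      exact ⟨a, ha, hab⟩

/-- Tree duality of an encoded digraph, in terms of lists. -/
def CodeTreeDuality (c : DigraphCode) : Prop :=
  ∃ w ∈ assignments (vertexSets c.1) (List.range c.1), ∀ p ∈ w, ∀ q ∈ w,
    ListSetArc c.2 p.1 q.1 → (p.2, q.2) ∈ c.2

theorem codeTreeDuality_iff (c : DigraphCode) :
    CodeTreeDuality c ↔ HomTo (powerDigraph (decode c)) (decode c) := by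
  classical
  constructor
  · rintro ⟨w, hw, h⟩
    obtain ⟨g, hg, rfl⟩ := (mem_assignments_iff (nodup_vertexSets _)).1 hw
    choose s hs hsA using fun A : {A : Set (Fin c.1) // A.Nonempty} => exists_mem_vertexSets A.1 A.2
    refine ⟨fun A => ⟨g (s A), by simpa using hg _ (hs A)⟩, fun A B hAB => ?_⟩
    refine h _ (List.mem_map_of_mem (hs A)) _ (List.mem_map_of_mem (hs B)) ?_
    rw [listSetArc_iff (hs A) (hs B), hsA, hsA]
    exact hAB
  · rintro ⟨f, hf⟩
    let g : List ℕ → ℕ := fun s =>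
      -- The value `0` is never used on `vertexSets`, whose members are nonempty lists of vertices.
      if h : {x : Fin c.1 | (x : ℕ) ∈ s}.Nonempty then f ⟨_, h⟩ else 0
    have hgs : ∀ s (hs : s ∈ vertexSets c.1), g s = f ⟨_, nonempty_of_mem_vertexSets hs⟩ :=
      fun s hs => dif_pos (nonempty_of_mem_vertexSets hs)
    refine ⟨_, (mem_assignments_iff (nodup_vertexSets _)).2
      ⟨g, fun s hs => by simp [hgs s hs], rfl⟩, ?_⟩
    simp only [List.mem_map, forall_exists_index, and_imp]
    rintro _ s hs rfl _ t ht rfl hst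
    simp only [hgs s hs, hgs t ht]
    exact hf _ _ ((listSetArc_iff hs ht).1 hst)

/-! ### Walks of binary operations on an encoded digraph -/

/-- The pairs of vertices. -/
def vertexPairs (n : ℕ) : List (ℕ × ℕ) :=
  (List.range n).flatMap fun a => (List.range n).map fun b => (a, b)

theorem mem_vertexPairs {n : ℕ} {p : ℕ × ℕ} : p ∈ vertexPairs n ↔ p.1 < n ∧ p.2 < n := by
  rcases p with ⟨a, b⟩
  simp [vertexPairs]

theorem nodup_vertexPairs (n : ℕ) : (vertexPairs n).Nodup :=
  List.Nodup.product List.nodup_range List.nodup_range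

/-- The tables of all binary operations. -/
def binaryTables (n : ℕ) : List (List ((ℕ × ℕ) × ℕ)) :=
  assignments (vertexPairs n) (List.range n)

/-- The table of a binary operation. -/
def binaryTable {n : ℕ} (φ : Fin n × Fin n → Fin n) : List ((ℕ × ℕ) × ℕ) :=
  (vertexPairs n).map fun p =>
    (p, if h : p.1 < n ∧ p.2 < n then (φ (⟨p.1, h.1⟩, ⟨p.2, h.2⟩) : ℕ) else 0)

theorem forall_mem_binaryTable {n : ℕ} {φ : Fin n × Fin n → Fin n} {P : (ℕ × ℕ) × ℕ → Prop} :
    (∀ p ∈ binaryTable φ, P p) ↔ ∀ a b : Fin n, P (((a : ℕ), (b : ℕ)), (φ (a, b) : ℕ)) := by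
  simp only [binaryTable, List.mem_map, forall_exists_index, and_imp]
  constructor
  · intro h a b
    simpa using h _ (a, b) (mem_vertexPairs.2 ⟨a.2, b.2⟩) rfl
  · rintro h _ ⟨a, b⟩ hab rfl
    rw [mem_vertexPairs] at hab
    simpa [hab.1, hab.2] using h ⟨a, hab.1⟩ ⟨b, hab.2⟩

theorem binaryTable_mem {n : ℕ} (φ : Fin n × Fin n → Fin n) : binaryTable φ ∈ binaryTables n :=
  (mem_assignments_iff (nodup_vertexPairs n)).2 ⟨_, fun p hp => by
    rw [mem_vertexPairs] at hp
    simp [hp], rfl⟩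

theorem exists_eq_binaryTable {n : ℕ} {w : List ((ℕ × ℕ) × ℕ)} (hw : w ∈ binaryTables n) :
    ∃ φ : Fin n × Fin n → Fin n, binaryTable φ = w := by
  obtain ⟨g, hg, rfl⟩ := (mem_assignments_iff (nodup_vertexPairs n)).1 hw
  refine ⟨fun p => ⟨g (p.1, p.2), by simpa using hg _ (mem_vertexPairs.2 ⟨p.1.2, p.2.2⟩)⟩,
    List.map_congr_left fun p hp => ?_⟩
  rw [mem_vertexPairs] at hp
  simp [hp]

theorem exists_mem_binaryTables {n : ℕ} {P : List ((ℕ × ℕ) × ℕ) → Prop} :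
    (∃ w ∈ binaryTables n, P w) ↔ ∃ φ : Fin n × Fin n → Fin n, P (binaryTable φ) := by
  constructor
  · rintro ⟨w, hw, h⟩
    obtain ⟨φ, rfl⟩ := exists_eq_binaryTable hw
    exact ⟨φ, h⟩
  · rintro ⟨φ, h⟩
    exact ⟨_, binaryTable_mem φ, h⟩

/-- Needed to recover a reachable operation from its table in `tableReach_iff`. -/
theorem binaryTable_injective {n : ℕ} :
    Function.Injective (binaryTable : (Fin n × Fin n → Fin n) → _) := by
  intro φ ψ h
  have key := (forall_mem_binaryTable (φ := φ)
    (P := fun p => ∀ a b : Fin n, p.1 = ((a : ℕ), (b : ℕ)) → p.2 = ψ (a, b))).1 (by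
      rw [h, forall_mem_binaryTable]
      intro a b a' b' hab
      simp only [Prod.mk.injEq, Fin.val_inj] at hab
      rw [hab.1, hab.2])
  funext ⟨a, b⟩
  exact Fin.ext (key a b a b rfl)

/-- Arcs between tables of binary operations. -/
def TableArc (L : List (ℕ × ℕ)) (φ ψ : List ((ℕ × ℕ) × ℕ)) : Prop :=
  ∀ p ∈ φ, ∀ q ∈ ψ, (p.1.1, q.1.1) ∈ L → (p.1.2, q.1.2) ∈ L → (p.2, q.2) ∈ L

theorem tableArc_iff {c : DigraphCode} {φ ψ : Fin c.1 × Fin c.1 → Fin c.1} :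
    TableArc c.2 (binaryTable φ) (binaryTable ψ) ↔ BinaryArc (decode c) φ ψ := by
  simp only [TableArc, forall_mem_binaryTable]
  rfl

/-- `ψ` belongs to every set of tables containing the out-neighbours of `φ` and closed under
taking out-neighbours. -/
def TableReach (c : DigraphCode) (φ ψ : List ((ℕ × ℕ) × ℕ)) : Prop :=
  ∀ S ∈ (binaryTables c.1).sublists', (∀ χ ∈ binaryTables c.1, TableArc c.2 φ χ → χ ∈ S) →
    (∀ θ ∈ S, ∀ χ ∈ binaryTables c.1, TableArc c.2 θ χ → χ ∈ S) → ψ ∈ S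

theorem tableReach_iff {c : DigraphCode} {φ ψ : Fin c.1 × Fin c.1 → Fin c.1} :
    TableReach c (binaryTable φ) (binaryTable ψ) ↔ TransGen (BinaryArc (decode c)) φ ψ := by
  classical
  constructor
  · intro h
    -- The tables of operations reachable from `φ` form one of the closed sets tested.
    have hmem := h ((binaryTables c.1).filter
      fun w => ∃ χ, TransGen (BinaryArc (decode c)) φ χ ∧ binaryTable χ = w) (by simp) ?_ ?_
    · obtain ⟨χ, hχ, heq⟩ : ∃ χ, TransGen (BinaryArc (decode c)) φ χ ∧
          binaryTable χ = binaryTable ψ := by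
        simpa using (List.mem_filter.1 hmem).2
      rwa [binaryTable_injective heq] at hχ
    · intro w hw harc
      obtain ⟨χ, rfl⟩ := exists_eq_binaryTable hw
      exact List.mem_filter.2 ⟨hw, by simpa using ⟨χ, .single (tableArc_iff.1 harc), rfl⟩⟩
    · intro v hv w hw harc
      obtain ⟨θ, hθ, rfl⟩ : ∃ θ, TransGen (BinaryArc (decode c)) φ θ ∧ binaryTable θ = v := by
        simpa using (List.mem_filter.1 hv).2
      obtain ⟨χ, rfl⟩ := exists_eq_binaryTable hw
      exact List.mem_filter.2 ⟨hw, by simpa using ⟨χ, hθ.tail (tableArc_iff.1 harc), rfl⟩⟩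
  · intro h S _ hφ hS
    induction h with
    | single h => exact hφ _ (binaryTable_mem _) (tableArc_iff.2 h)
    | tail _ h ih => exact hS _ ih _ (binaryTable_mem _) (tableArc_iff.2 h)

/-- The walk condition for bounded-height tree duality, in terms of lists. -/
def CodeWalk (c : DigraphCode) : Prop :=
  ∃ φ ∈ binaryTables c.1, ∃ ψ ∈ binaryTables c.1,
    ((∀ p ∈ φ, ∀ q ∈ φ, p.1.2 = q.1.2 → p.2 = q.2) ∧
      ∀ p ∈ φ, ∀ q ∈ ψ, p.1 = (q.1.2, q.1.1) → p.2 = q.2) ∧ TableReach c φ ψ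

theorem codeWalk_iff (c : DigraphCode) :
    CodeWalk c ↔ ∃ φ : Fin c.1 × Fin c.1 → Fin c.1, (∀ a a' b, φ (a, b) = φ (a', b)) ∧
      TransGen (BinaryArc (decode c)) φ (φ ∘ Prod.swap) := by
  simp only [CodeWalk, exists_mem_binaryTables, forall_mem_binaryTable, tableReach_iff,
    Prod.mk.injEq, Fin.val_inj]
  constructor
  · rintro ⟨φ, ψ, ⟨h₁, h₂⟩, h⟩
    obtain rfl : ψ = φ ∘ Prod.swap := by
      funext ⟨a, b⟩
      exact (h₂ b a a b ⟨rfl, rfl⟩).symm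
    exact ⟨φ, fun a a' b => h₁ a b a' b rfl, h⟩
  · rintro ⟨φ, h₁, h⟩
    refine ⟨φ, _, ⟨?_, ?_⟩, h⟩
    · rintro a b a' _ rfl
      exact h₁ a a' b
    · rintro a b _ _ ⟨rfl, rfl⟩
      rfl

/-! ### Computability -/

open Primrec

theorem primrec_vertexSets : Primrec vertexSets :=
  (Primrec.listFilter (Primrec.eq.comp Primrec.id (Primrec.const [])).not).comp
    (Primrec.list_sublists'.comp Primrec.list_range)

theorem primrec_vertexPairs : Primrec vertexPairs :=
  Primrec.list_flatMap Primrec.list_range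
    (Primrec.list_map (Primrec.list_range.comp fst) ((snd.comp fst).pair snd))

theorem primrec_binaryTables : Primrec binaryTables :=
  primrec_assignments.comp primrec_vertexPairs Primrec.list_range

theorem primrecPred_listSetArc :
    PrimrecPred fun x : List (ℕ × ℕ) × List ℕ × List ℕ => ListSetArc x.1 x.2.1 x.2.2 := by
  refine PrimrecPred.and ?_ ?_
  · refine PrimrecPred.forall_mem (fst.comp snd) (PrimrecPred.exists_mem
      (snd.comp (snd.comp fst)) (PrimrecPred.mem ((snd.comp fst).pair snd)
        (fst.comp (fst.comp fst))))
  · refine PrimrecPred.forall_mem (snd.comp snd) (PrimrecPred.exists_mem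
      (fst.comp (snd.comp fst)) (PrimrecPred.mem (snd.pair (snd.comp fst))
        (fst.comp (fst.comp fst))))

theorem primrecPred_codeTreeDuality : PrimrecPred CodeTreeDuality := by
  refine PrimrecPred.exists_mem (primrec_assignments.comp (primrec_vertexSets.comp fst)
    (Primrec.list_range.comp fst)) ?_
  refine PrimrecPred.forall_mem snd (PrimrecPred.forall_mem (snd.comp fst) (PrimrecPred.imp ?_ ?_))
  · exact primrecPred_listSetArc.comp ((snd.comp (fst.comp (fst.comp fst))).pair
      ((fst.comp (snd.comp fst)).pair (fst.comp snd)))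
  · exact PrimrecPred.mem ((snd.comp (snd.comp fst)).pair (snd.comp snd))
      (snd.comp (fst.comp (fst.comp fst)))

theorem primrecPred_tableArc : PrimrecPred
    fun x : List (ℕ × ℕ) × List ((ℕ × ℕ) × ℕ) × List ((ℕ × ℕ) × ℕ) =>
      TableArc x.1 x.2.1 x.2.2 := by
  refine PrimrecPred.forall_mem (fst.comp snd) (PrimrecPred.forall_mem (snd.comp (snd.comp fst)) ?_)
  have hL := fst.comp (fst.comp (fst (α := (List (ℕ × ℕ) × List ((ℕ × ℕ) × ℕ) ×
    List ((ℕ × ℕ) × ℕ)) × (ℕ × ℕ) × ℕ) (β := (ℕ × ℕ) × ℕ)))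
  refine PrimrecPred.imp (PrimrecPred.mem ?_ hL)
    (PrimrecPred.imp (PrimrecPred.mem ?_ hL) (PrimrecPred.mem ?_ hL))
  · exact (fst.comp (fst.comp (snd.comp fst))).pair (fst.comp (fst.comp snd))
  · exact (snd.comp (fst.comp (snd.comp fst))).pair (snd.comp (fst.comp snd))
  · exact (snd.comp (snd.comp fst)).pair (snd.comp snd)

theorem primrecPred_tableReach : PrimrecPred
    fun x : DigraphCode × List ((ℕ × ℕ) × ℕ) × List ((ℕ × ℕ) × ℕ) =>
      TableReach x.1 x.2.1 x.2.2 := by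
  refine PrimrecPred.forall_mem (list_sublists'.comp (primrec_binaryTables.comp (fst.comp fst)))
    (PrimrecPred.imp ?_ (PrimrecPred.imp ?_ ?_))
  · refine PrimrecPred.forall_mem (primrec_binaryTables.comp (fst.comp (fst.comp fst)))
      (PrimrecPred.imp ?_ (PrimrecPred.mem snd (snd.comp fst)))
    exact primrecPred_tableArc.comp ((snd.comp (fst.comp (fst.comp fst))).pair
      ((fst.comp (snd.comp (fst.comp fst))).pair snd))
  · refine PrimrecPred.forall_mem snd (PrimrecPred.forall_mem
      (primrec_binaryTables.comp (fst.comp (fst.comp (fst.comp fst))))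
      (PrimrecPred.imp ?_ (PrimrecPred.mem snd (snd.comp (fst.comp fst)))))
    exact primrecPred_tableArc.comp ((snd.comp (fst.comp (fst.comp (fst.comp fst)))).pair
      ((snd.comp fst).pair snd))
  · exact PrimrecPred.mem (snd.comp (snd.comp fst)) snd

theorem primrecPred_codeWalk : PrimrecPred CodeWalk := by
  refine PrimrecPred.exists_mem (primrec_binaryTables.comp fst) (PrimrecPred.exists_mem
    (primrec_binaryTables.comp (fst.comp fst)) (PrimrecPred.and (PrimrecPred.and ?_ ?_) ?_))
  · refine PrimrecPred.forall_mem (snd.comp fst) (PrimrecPred.forall_mem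
      (snd.comp (fst.comp fst)) (PrimrecPred.imp ?_ ?_))
    · exact Primrec.eq.comp (snd.comp (fst.comp (snd.comp fst))) (snd.comp (fst.comp snd))
    · exact Primrec.eq.comp (snd.comp (snd.comp fst)) (snd.comp snd)
  · refine PrimrecPred.forall_mem (snd.comp fst) (PrimrecPred.forall_mem
      (snd.comp fst) (PrimrecPred.imp ?_ ?_))
    · exact Primrec.eq.comp (fst.comp (snd.comp fst))
        ((snd.comp (fst.comp snd)).pair (fst.comp (fst.comp snd)))
    · exact Primrec.eq.comp (snd.comp (snd.comp fst)) (snd.comp snd)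
  · exact primrecPred_tableReach.comp ((fst.comp fst).pair ((snd.comp fst).pair snd))

end BoundedHeightTreeDuality

/-- The problem whether an input digraph has bounded-height tree duality is decidable. -/
theorem corollary3p3 :
    ComputablePred fun c : BoundedHeightTreeDuality.DigraphCode =>
      BoundedHeightTreeDuality.HasBoundedHeightTreeDuality
        (BoundedHeightTreeDuality.decode c) := by
  open BoundedHeightTreeDuality in
  refine ((primrecPred_codeTreeDuality.and primrecPred_codeWalk).of_eq fun c => ?_).computablePred
  rw [hasBoundedHeightTreeDuality_iff_walk, codeTreeDuality_iff, codeWalk_iff]
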